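/- Let $p>1$ and $0<u<p$ be real numbers and let $d\ge 0$ be an integer. Write $(x)_i=\prod_{j=0}^{i-1}(1-x/p^j)$. For a partition $\lambda$ let $|\lambda|$ be its size, $r(\lambda)$ its number of parts, $m_i(\lambda)$ the number of its parts of size $i$, $\lambda_i'=\sum_{j\ge i}m_j(\lambda)$, and put $$|\mathrm{Aut}(\lambda)|=p^{\sum_i(\lambda_i')^2}\prod_i(1/p)_{m_i(\lambda)},\qquad P_{d,u}(\lambda)=\frac{u^{|\lambda|}}{|\mathrm{Aut}(\lambda)|}\prod_{i=1}^d\Bigl(1-\frac u{p^i}\Bigr)\prod_{i=d-r(\lambda)+1}^d\Bigl(1-\frac1{p^i}\Bigr)$$ if $r(\lambda)\le d$, and $P_{d,u}(\lambda)=0$ if $r(\lambda)>d$. For partitions $\lambda,\mu$ there is a unique polynomial in $\mathbb Z[X]$ whose value at each prime $q$ is the number of subgroups isomorphic to $\prod_i\mathbb Z/q^{\mu_i}\mathbb{Z}$ of the group $\prod_i\mathbb Z/q^{\lambda_i}\mathbb{Z}$; let $n_\lambda(\mu)$ be its value at $p$, and put $|\mathrm{Sur}(\lambda,\mu)|=n_\lambda(\mu)\,|\mathrm{Aut}(\mu)|$.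 Then for every partition $\mu$, the series below, over all partitions $\lambda$, converges (absolutely) and $$\sum_\lambda P_{d,u}(\lambda)\,|\mathrm{Sur}(\lambda,\mu)|=\begin{cases}\dfrac{u^{|\mu|}(1/p)_d}{(1/p)_{d-r(\mu)}}&\text{if } r(\mu)\le d,\\[2mm]0&\text{otherwise.}\end{cases}$$ If $p$ is prime, the same holds with $|\mathrm{Sur}(\lambda,\mu)|$ replaced by the number of surjective homomorphisms from $\prod_i\mathbb Z/p^{\lambda_i}\mathbb{Z}$ to $\prod_i\mathbb Z/p^{\mu_i}\mathbb{Z}$. -/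

import Mathlib

/-! Partitions are Young diagrams: for `lam : YoungDiagram`, the (nonzero) parts are `lam.rowLens`,
the part `λ_i` is `lam.rowLen (i - 1)`, the column length `λ'_i` is `lam.colLen (i - 1)`,
the size `|λ|` is `lam.card`. -/

/-- The number `r(λ)` of parts of a partition. -/
def numParts (lam : YoungDiagram) : ℕ := lam.rowLens.length

/-- The number `m_i(λ)` of parts of size `i`. -/
def partMult (lam : YoungDiagram) (i : ℕ) : ℕ := lam.rowLens.count i

/-- `(x)_i = (1 - x) (1 - x / p) ⋯ (1 - x / p ^ (i - 1))`. -/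
noncomputable def poch (p x : ℝ) (i : ℕ) : ℝ := ∏ j ∈ Finset.range i, (1 - x / p ^ j)

/-- `|Aut(λ)| = p ^ (∑ (λ'_i) ^ 2) * ∏ (1/p)_{m_i(λ)}`, for any real `p`.  The index `i` runs over
`1, …, λ_1`; all further factors and summands are trivial. -/
noncomputable def autCard (p : ℝ) (lam : YoungDiagram) : ℝ :=
  p ^ (∑ i ∈ Finset.Icc 1 (lam.rowLen 0), (lam.colLen (i - 1)) ^ 2) *
    ∏ i ∈ Finset.Icc 1 (lam.rowLen 0), poch p (1 / p) (partMult lam i)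

/-- The mass `P_{d,u}(λ)`, with parameter `p`; it vanishes on partitions with more than `d` parts. -/
noncomputable def massP (p u : ℝ) (d : ℕ) (lam : YoungDiagram) : ℝ :=
  if numParts lam ≤ d then
    u ^ lam.card / autCard p lam *
      (∏ i ∈ Finset.Icc 1 d, (1 - u / p ^ i)) *
      ∏ i ∈ Finset.Icc (d - numParts lam + 1) d, (1 - 1 / p ^ i)
  else 0

/-- The standard abelian `q`-group of type `λ`, the product of the `ℤ / q ^ λ_i`. -/
abbrev TypeGroup (q : ℕ) (lam : YoungDiagram) : Type :=
  (i : Fin (numParts lam)) → ZMod (q ^ lam.rowLen i)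

/-- The abelian group `G` is a `q`-group of type `λ`. -/
def HasType (q : ℕ) (G : Type) [AddCommGroup G] (lam : YoungDiagram) : Prop :=
  Nonempty (G ≃+ TypeGroup q lam)

/-- The number of subgroups of type `μ` of a finite abelian `q`-group of type `λ`. -/
noncomputable def subgroupCount (q : ℕ) (lam mu : YoungDiagram) : ℕ :=
  Nat.card {H : AddSubgroup (TypeGroup q lam) // HasType q H mu}

/-- The integer polynomial `f` gives, at every prime `q`, the number of subgroups of type `μ` of a
finite abelian `q`-group of type `λ`. -/
def IsSubgroupPoly (lam mu : YoungDiagram) (f : Polynomial ℤ) : Prop :=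
  ∀ q : ℕ, q.Prime → f.eval (q : ℤ) = (subgroupCount q lam mu : ℤ)

/-- There is at most one such polynomial. -/
theorem IsSubgroupPoly.unique {lam mu : YoungDiagram} {f g : Polynomial ℤ}
    (hf : IsSubgroupPoly lam mu f) (hg : IsSubgroupPoly lam mu g) : f = g := by
  refine Polynomial.eq_of_infinite_eval_eq f g ?_
  refine (Nat.infinite_setOfPred_prime.image (f := fun n : ℕ => (n : ℤ))
    Nat.cast_injective.injOn).mono ?_
  rintro _ ⟨q, hq, rfl⟩
  exact (hf q hq).trans (hg q hq).symm

open Classical in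
/-- The polynomial `n_λ(μ)`: the unique polynomial that counts, at every prime `q`, the subgroups of
type `μ` of a finite abelian `q`-group of type `λ`. -/
noncomputable def subgroupPoly (lam mu : YoungDiagram) : Polynomial ℤ :=
  if h : ∃ f : Polynomial ℤ, IsSubgroupPoly lam mu f then h.choose else 0

/-- `|Sur(λ, μ)| = n_λ(μ) |Aut(μ)|`, for any real `p`. -/
noncomputable def surCard (p : ℝ) (lam mu : YoungDiagram) : ℝ :=
  Polynomial.aeval p (subgroupPoly lam mu) * autCard p mu

/-- The value `u ^ |μ| (1/p)_d / (1/p)_{d - r(μ)}` if `r(μ) ≤ d`, and `0` otherwise. -/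
noncomputable def momentValue (p u : ℝ) (d : ℕ) (mu : YoungDiagram) : ℝ :=
  if numParts mu ≤ d then
    u ^ mu.card * poch p (1 / p) d / poch p (1 / p) (d - numParts mu)
  else 0

/-! For a prime `q`, duality of finite abelian groups gives as many surjections from type `lam` to
type `mu` as injections from type `mu` to type `lam` (`card_surjective_eq_card_injHom`). Injections
are counted by choosing the images of the generators one at a time, those of largest order first;
the count is the value at `q` of an explicit product, `injPoly mu lam`. The polynomial `injPoly mu
mu` is monic and its value divides that of `injPoly mu lam` at every prime, so the quotient is a
polynomial and counts subgroups. Since `injPoly mu mu` takes the value `autCard p mu` at real `p >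
1`, `surCard p lam mu` is the value of `injPoly mu lam` at `p` (`surCard_eq`).

What remains is a sum over partitions for real `p`. Removing the first column of `lam`, of length
`b`, leaves a partition with at most `b` parts, and the mass factors into a term in `d` and `b`
times the same kind of mass with `b` in place of `d` (`chainWeight_addCol`): the column lengths form
a Markov chain. The injection polynomial factors in the same way when both diagrams lose their first
column (`injPoly_addCol`). So the moment for `mu` follows from that for `mu` without its first
column by a finite sum over `b`, which `sum_durfee` evaluates. The base case, empty `mu`, says that
the total mass is one (`hasSum_chainWeight`). -/

open Polynomial

/-! ### Young diagrams: adding and removing the first column. -/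

namespace YoungDiagram

theorem colLen_eq_iff {lam : YoungDiagram} {j n : ℕ} :
    lam.colLen j = n ↔ ∀ i, (i, j) ∈ lam ↔ i < n := by
  simp only [mem_iff_lt_colLen]
  constructor
  · rintro rfl i
    rfl
  · intro h
    have h1 := h n
    have h2 := h (lam.colLen j)
    omega

theorem rowLen_eq_iff {lam : YoungDiagram} {i n : ℕ} :
    lam.rowLen i = n ↔ ∀ j, (i, j) ∈ lam ↔ j < n := by
  simp only [mem_iff_lt_rowLen]
  constructor
  · rintro rfl i
    rfl
  · intro h
    have h1 := h n
    have h2 := h (lam.rowLen i)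
    omega

theorem lt_rowLen_iff_lt_colLen {lam : YoungDiagram} {i j : ℕ} :
    j < lam.rowLen i ↔ i < lam.colLen j := by
  rw [← mem_iff_lt_colLen, mem_iff_lt_rowLen]

/-- The diagram obtained by putting a column of length `b` to the left of the first `b` rows of
`nu`. -/
def addCol (b : ℕ) (nu : YoungDiagram) : YoungDiagram where
  cells := (Finset.range b ×ˢ Finset.range (nu.rowLen 0 + 1)).filter
    fun c => c.2 = 0 ∨ (c.1, c.2 - 1) ∈ nu
  isLowerSet := by
    rintro ⟨i2, j2⟩ ⟨i1, j1⟩ ⟨hi : i1 ≤ i2, hj : j1 ≤ j2⟩ h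
    simp only [Finset.coe_filter, Finset.mem_product, Finset.mem_range, Set.mem_ofPred_eq] at h ⊢
    refine ⟨⟨by omega, by omega⟩, ?_⟩
    rcases h.2 with h2 | h2
    · exact Or.inl (by omega)
    · exact Or.inr (nu.up_left_mem hi (by omega) h2)

/-- The diagram without its first column. -/
def removeCol (lam : YoungDiagram) : YoungDiagram where
  cells := (Finset.range (lam.colLen 0) ×ˢ Finset.range (lam.rowLen 0)).filter
    fun c => (c.1, c.2 + 1) ∈ lam
  isLowerSet := by
    rintro ⟨i2, j2⟩ ⟨i1, j1⟩ ⟨hi : i1 ≤ i2, hj : j1 ≤ j2⟩ h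
    simp only [Finset.coe_filter, Finset.mem_product, Finset.mem_range, Set.mem_ofPred_eq] at h ⊢
    exact ⟨⟨by omega, by omega⟩, lam.up_left_mem hi (by omega) h.2⟩

theorem mem_addCol_zero {b : ℕ} {nu : YoungDiagram} {i : ℕ} :
    (i, 0) ∈ addCol b nu ↔ i < b := by
  rw [← mem_cells]
  simp [addCol]

theorem mem_addCol_succ {b : ℕ} {nu : YoungDiagram} {i j : ℕ} :
    (i, j + 1) ∈ addCol b nu ↔ i < b ∧ (i, j) ∈ nu := by
  rw [← mem_cells]
  simp only [addCol, Finset.mem_filter, Finset.mem_product, Finset.mem_range]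
  constructor
  · rintro ⟨⟨h1, -⟩, h2⟩
    exact ⟨h1, by simpa using h2⟩
  · rintro ⟨h1, h2⟩
    have := mem_iff_lt_rowLen.1 (nu.up_left_mem (Nat.zero_le i) le_rfl h2)
    exact ⟨⟨h1, by omega⟩, Or.inr h2⟩

theorem mem_removeCol {lam : YoungDiagram} {i j : ℕ} :
    (i, j) ∈ removeCol lam ↔ (i, j + 1) ∈ lam := by
  rw [← mem_cells]
  simp only [removeCol, Finset.mem_filter, Finset.mem_product, Finset.mem_range,
    and_iff_right_iff_imp]
  intro h
  have h1 := mem_iff_lt_rowLen.1 (lam.up_left_mem (Nat.zero_le i) (Nat.le_succ j) h)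
  have h2 := mem_iff_lt_colLen.1 (lam.up_left_mem le_rfl (Nat.zero_le (j + 1)) h)
  exact ⟨h2, h1⟩

theorem colLen_addCol_zero (b : ℕ) (nu : YoungDiagram) : (addCol b nu).colLen 0 = b :=
  colLen_eq_iff.2 fun _ => mem_addCol_zero

theorem colLen_addCol_succ {b : ℕ} {nu : YoungDiagram} (h : nu.colLen 0 ≤ b) (j : ℕ) :
    (addCol b nu).colLen (j + 1) = nu.colLen j := by
  refine colLen_eq_iff.2 fun i => ?_
  rw [mem_addCol_succ, mem_iff_lt_colLen, and_iff_right_iff_imp]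
  have := nu.colLen_anti 0 j (Nat.zero_le j)
  omega

theorem rowLen_addCol {b : ℕ} {nu : YoungDiagram} {i : ℕ} (h : i < b) :
    (addCol b nu).rowLen i = nu.rowLen i + 1 := by
  refine rowLen_eq_iff.2 fun j => ?_
  cases j with
  | zero => simpa [mem_addCol_zero] using h
  | succ j => rw [mem_addCol_succ, mem_iff_lt_rowLen]; omega

theorem colLen_removeCol (lam : YoungDiagram) (j : ℕ) :
    lam.removeCol.colLen j = lam.colLen (j + 1) :=
  colLen_eq_iff.2 fun i => by rw [mem_removeCol, mem_iff_lt_colLen]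

theorem rowLen_removeCol (lam : YoungDiagram) (i : ℕ) :
    lam.removeCol.rowLen i = lam.rowLen i - 1 :=
  rowLen_eq_iff.2 fun j => by rw [mem_removeCol, mem_iff_lt_rowLen]; omega

theorem colLen_removeCol_le (lam : YoungDiagram) : lam.removeCol.colLen 0 ≤ lam.colLen 0 := by
  rw [colLen_removeCol]
  exact lam.colLen_anti _ _ (Nat.zero_le _)

theorem addCol_removeCol (lam : YoungDiagram) : addCol (lam.colLen 0) lam.removeCol = lam := by
  ext ⟨i, j⟩
  rw [mem_cells, mem_cells]
  cases j with
  | zero => rw [mem_addCol_zero, mem_iff_lt_colLen]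
  | succ j =>
    rw [mem_addCol_succ, mem_removeCol, and_iff_right_iff_imp]
    exact fun h => mem_iff_lt_colLen.1 (lam.up_left_mem le_rfl (Nat.zero_le _) h)

theorem removeCol_addCol {b : ℕ} {nu : YoungDiagram} (h : nu.colLen 0 ≤ b) :
    (addCol b nu).removeCol = nu := by
  ext ⟨i, j⟩
  rw [mem_cells, mem_cells, mem_removeCol, mem_addCol_succ, and_iff_right_iff_imp]
  exact fun hm => (mem_iff_lt_colLen.1 (nu.up_left_mem le_rfl (Nat.zero_le _) hm)).trans_le h

theorem card_addCol {b : ℕ} {nu : YoungDiagram} (h : nu.colLen 0 ≤ b) :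
    (addCol b nu).card = b + nu.card := by
  have hinj : Function.Injective fun c : ℕ × ℕ => (c.1, c.2 + 1) := by
    rintro ⟨a, b⟩ ⟨c, d⟩ h
    simpa using h
  have key : (addCol b nu).cells =
      Finset.range b ×ˢ {0} ∪ nu.cells.map ⟨fun c => (c.1, c.2 + 1), hinj⟩ := by
    ext ⟨i, j⟩
    rw [mem_cells]
    cases j with
    | zero => simp [mem_addCol_zero]
    | succ j =>
      have hm : (i, j) ∈ nu → i < b := fun hm =>
        (mem_iff_lt_colLen.1 (nu.up_left_mem le_rfl (Nat.zero_le _) hm)).trans_le h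
      simp [mem_addCol_succ]
      exact hm
  rw [YoungDiagram.card, key, Finset.card_union_of_disjoint]
  · simp
  · rw [Finset.disjoint_left]
    rintro ⟨i, j⟩ h1 h2
    simp only [Finset.mem_product, Finset.mem_singleton] at h1
    simp only [Finset.mem_map, Function.Embedding.coeFn_mk, Prod.mk.injEq] at h2
    obtain ⟨_, -, -, h3⟩ := h2
    omega

theorem colLen_bot (j : ℕ) : (⊥ : YoungDiagram).colLen j = 0 :=
  colLen_eq_iff.2 fun i => by simp

theorem rowLen_bot (i : ℕ) : (⊥ : YoungDiagram).rowLen i = 0 :=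
  rowLen_eq_iff.2 fun i => by simp

theorem eq_bot_iff_colLen {lam : YoungDiagram} : lam = ⊥ ↔ lam.colLen 0 = 0 := by
  refine ⟨fun h => h ▸ colLen_bot 0, fun h => ?_⟩
  ext ⟨i, j⟩
  rw [mem_cells, mem_iff_lt_colLen]
  have := lam.colLen_anti 0 j (Nat.zero_le j)
  simp
  omega

theorem eq_bot_iff_rowLen {lam : YoungDiagram} : lam = ⊥ ↔ lam.rowLen 0 = 0 := by
  have := @lt_rowLen_iff_lt_colLen lam 0 0
  rw [eq_bot_iff_colLen]
  omega

/-- Induction on the number of columns. -/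
theorem addCol_induction {P : YoungDiagram → Prop} (bot : P ⊥)
    (step : ∀ (b : ℕ) (nu : YoungDiagram), 0 < b → nu.colLen 0 ≤ b → P nu → P (addCol b nu))
    (lam : YoungDiagram) : P lam := by
  induction hn : lam.rowLen 0 generalizing lam with
  | zero => rw [eq_bot_iff_rowLen.2 hn]; exact bot
  | succ n ih =>
    rw [← addCol_removeCol lam]
    refine step _ _ ?_ lam.colLen_removeCol_le (ih _ ?_)
    · rw [← lt_rowLen_iff_lt_colLen]
      omega
    · rw [rowLen_removeCol]
      omega

end YoungDiagram

open YoungDiagram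

/-! ### Automorphism numbers and injection polynomials, column by column. -/

theorem numParts_eq (lam : YoungDiagram) : numParts lam = lam.colLen 0 := length_rowLens

theorem partMult_succ (lam : YoungDiagram) (j : ℕ) :
    partMult lam (j + 1) = lam.colLen j - lam.colLen (j + 1) := by
  have h : partMult lam (j + 1) =
      ((Finset.range (lam.colLen 0)).filter fun i => lam.rowLen i = j + 1).card := by
    rw [partMult, rowLens, List.count, List.countP_map, List.countP_eq_length_filter]
    rfl
  rw [h, ← Nat.card_Ico]
  congr 1
  ext i
  have h1 := @lt_rowLen_iff_lt_colLen lam i j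
  have h2 := @lt_rowLen_iff_lt_colLen lam i (j + 1)
  have h3 := lam.colLen_anti 0 j (Nat.zero_le j)
  simp only [Finset.mem_filter, Finset.mem_range, Finset.mem_Ico]
  omega

theorem autCard_eq_prod (p : ℝ) (lam : YoungDiagram) :
    autCard p lam = ∏ j ∈ Finset.range (lam.rowLen 0),
      (p ^ lam.colLen j ^ 2 * poch p (1 / p) (lam.colLen j - lam.colLen (j + 1))) := by
  have hI : ∀ n, Finset.Icc 1 n = (Finset.range n).image (· + 1) := fun n => by
    ext i
    simp only [Finset.mem_Icc, Finset.mem_image, Finset.mem_range]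
    exact ⟨fun h => ⟨i - 1, by omega, by omega⟩, by rintro ⟨k, h, rfl⟩; omega⟩
  have hinj : Set.InjOn (· + 1) (Finset.range (lam.rowLen 0) : Set ℕ) :=
    (add_left_injective 1).injOn
  rw [autCard, hI, Finset.sum_image hinj, Finset.prod_image hinj, ← Finset.prod_pow_eq_pow_sum,
    ← Finset.prod_mul_distrib]
  simp [partMult_succ]

theorem autCard_bot (p : ℝ) : autCard p ⊥ = 1 := by
  simp [autCard_eq_prod, rowLen_bot]

theorem autCard_addCol (p : ℝ) {b : ℕ} {nu : YoungDiagram} (h : nu.colLen 0 ≤ b) :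
    autCard p (addCol b nu) = p ^ b ^ 2 * poch p (1 / p) (b - nu.colLen 0) * autCard p nu := by
  rcases Nat.eq_zero_or_pos b with rfl | hb
  · have h1 : nu = ⊥ := eq_bot_iff_colLen.2 (by omega)
    have h2 : addCol 0 nu = ⊥ := eq_bot_iff_colLen.2 (colLen_addCol_zero _ _)
    simp [h1 ▸ h2, h1, autCard_bot, poch]
  · rw [autCard_eq_prod, rowLen_addCol hb, Finset.prod_range_succ', autCard_eq_prod, mul_comm]
    simp only [colLen_addCol_succ h, colLen_addCol_zero]

/-- The polynomial whose value at a prime `q` is the number of injective homomorphisms from a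
finite abelian `q`-group of type `mu` to one of type `lam`. -/
noncomputable def injPoly (mu lam : YoungDiagram) : ℤ[X] :=
  ∏ j ∈ Finset.range (mu.colLen 0),
    -- The first `k` columns of `lam` add up to the exponent of the order of the `q ^ k`-torsion.
    -- With `k = mu.rowLen j`, the factor counts the `q ^ k`-torsion elements whose `q ^ (k -
    -- 1)`-multiple avoids the image of the first `j` generators. Here `mu.rowLen j` is positive, so
    -- the subtraction is not truncated.
    (X ^ (∑ i ∈ Finset.range (mu.rowLen j), lam.colLen i) -
      X ^ (j + ∑ i ∈ Finset.range (mu.rowLen j - 1), lam.colLen i))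

theorem injPoly_bot (lam : YoungDiagram) : injPoly ⊥ lam = 1 := by
  simp [injPoly, colLen_bot]

/-- In each of the first `mu.colLen 0` rows both exponents grow by `b`. The other rows of the new
diagram have length one and contribute `X ^ b - X ^ j`. -/
theorem injPoly_addCol {m b : ℕ} {mu nu : YoungDiagram} (hm : mu.colLen 0 ≤ m)
    (hb : nu.colLen 0 ≤ b) :
    injPoly (addCol m mu) (addCol b nu) = X ^ (b * mu.colLen 0) * injPoly mu nu *
      ∏ j ∈ Finset.Ico (mu.colLen 0) m, (X ^ b - X ^ j) := by
  rw [injPoly, colLen_addCol_zero, ← Finset.prod_range_mul_prod_Ico _ hm]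
  congr 1
  · rw [injPoly, pow_mul, ← Finset.card_range (mu.colLen 0), ← Finset.prod_const,
      Finset.card_range, ← Finset.prod_mul_distrib]
    refine Finset.prod_congr rfl fun j hj => ?_
    rw [Finset.mem_range] at hj
    have h1 : 0 < mu.rowLen j := lt_rowLen_iff_lt_colLen.2 hj
    obtain ⟨k, hk⟩ : ∃ k, mu.rowLen j = k + 1 := ⟨mu.rowLen j - 1, by omega⟩
    rw [rowLen_addCol (hj.trans_le hm), hk]
    simp only [Nat.add_sub_cancel]
    have hS : ∀ n, ∑ i ∈ Finset.range (n + 1), (addCol b nu).colLen i =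
        ∑ i ∈ Finset.range n, nu.colLen i + b := fun n => by
      rw [Finset.sum_range_succ']
      simp only [colLen_addCol_succ hb, colLen_addCol_zero]
    rw [hS, hS]
    ring
  · refine Finset.prod_congr rfl fun j hj => ?_
    rw [Finset.mem_Ico] at hj
    have h1 : mu.rowLen j = 0 := by
      have := @lt_rowLen_iff_lt_colLen mu j 0
      omega
    rw [rowLen_addCol hj.2, h1]
    simp [colLen_addCol_zero]

/-- With `mu.rowLen j = k + 1`, the two exponents in row `j` differ by `mu.colLen k - j`, which is
positive because row `j` reaches column `k`. -/
theorem injPoly_self_monic (mu : YoungDiagram) : (injPoly mu mu).Monic := by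
  refine monic_prod_of_monic _ _ fun j hj => ?_
  rw [Finset.mem_range] at hj
  have h1 : 0 < mu.rowLen j := lt_rowLen_iff_lt_colLen.2 hj
  obtain ⟨k, hk⟩ : ∃ k, mu.rowLen j = k + 1 := ⟨mu.rowLen j - 1, by omega⟩
  have h2 : j < mu.colLen k := lt_rowLen_iff_lt_colLen.1 (by omega)
  rw [hk, Finset.sum_range_succ, Nat.add_sub_cancel]
  refine monic_X_pow_sub (degree_X_pow_le _ |>.trans_lt ?_)
  exact_mod_cast (by omega)

/-! ### Finite Pochhammer products and the summation identity. -/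

theorem poch_zero (p x : ℝ) : poch p x 0 = 1 := by simp [poch]

theorem poch_succ (p x : ℝ) (n : ℕ) : poch p x (n + 1) = poch p x n * (1 - x / p ^ n) := by
  rw [poch, Finset.prod_range_succ, ← poch]

theorem poch_succ' (p x : ℝ) (n : ℕ) : poch p x (n + 1) = (1 - x) * poch p (x / p) n := by
  rw [poch, Finset.prod_range_succ', mul_comm, poch]
  simp [pow_succ', div_div]

theorem poch_add (p x : ℝ) (m n : ℕ) : poch p x (m + n) = poch p x m * poch p (x / p ^ m) n := by
  simp only [poch]
  rw [Finset.prod_range_add]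
  simp [pow_add, div_div]

theorem one_sub_div_pow_pos {p x : ℝ} (hp : 1 < p) (h0 : 0 ≤ x) (h1 : x < 1) (n : ℕ) :
    0 < 1 - x / p ^ n := by
  have : x / p ^ n ≤ x := div_le_self h0 (one_le_pow₀ hp.le)
  linarith

theorem poch_pos {p x : ℝ} (hp : 1 < p) (h0 : 0 ≤ x) (h1 : x < 1) (n : ℕ) : 0 < poch p x n :=
  Finset.prod_pos fun j _ => one_sub_div_pow_pos hp h0 h1 j

theorem poch_le_one {p x : ℝ} (hp : 1 < p) (h0 : 0 ≤ x) (h1 : x < 1) (n : ℕ) : poch p x n ≤ 1 :=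
  Finset.prod_le_one (fun j _ => (one_sub_div_pow_pos hp h0 h1 j).le) fun j _ => by
    have : 0 ≤ x / p ^ j := by positivity
    linarith

theorem poch_inv_pos {p : ℝ} (hp : 1 < p) (n : ℕ) : 0 < poch p (1 / p) n :=
  poch_pos hp (by positivity) ((div_lt_one (by linarith)).2 hp) n

/-- A form of the `q`-Chu–Vandermonde summation. -/
theorem sum_durfee {p x : ℝ} (hp : 1 < p) (h0 : 0 ≤ x) (h1 : x < 1) (n : ℕ) :
    ∑ k ∈ Finset.range (n + 1), x ^ k * p ^ k / p ^ k ^ 2 /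
        (poch p (1 / p) k * poch p (1 / p) (n - k) * poch p x k) =
      1 / (poch p (1 / p) n * poch p x n) := by
  have hp0 : 0 < p := by linarith
  induction n generalizing x with
  | zero => simp [poch_zero]
  | succ n ih =>
    have hx0 : 0 ≤ x / p := by positivity
    have hx1 : x / p < 1 := (div_le_self h0 hp.le).trans_lt h1
    set T : ℕ → ℝ := fun k => x ^ k * p ^ k / p ^ k ^ 2 /
        (poch p (1 / p) k * poch p (1 / p) (n + 1 - k) * poch p x k) with hT
    have hq : 0 < 1 - 1 / p / p ^ n := one_sub_div_pow_pos hp (by positivity)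
      ((div_lt_one hp0).2 hp) n
    -- The split is `1 - p^{-(n+1)} = (p^{-k} - p^{-(n+1)}) + (1 - p^{-k})`. The first part vanishes
    -- at `k = n + 1` and the second at `k = 0`, so after a shift of the second both run over `k ≤
    -- n`.
    have hsplit : ∀ k ∈ Finset.range (n + 1 + 1), T k * (1 - 1 / p / p ^ n) =
        T k * ((1 - p ^ k / p ^ (n + 1)) / p ^ k) + T k * (1 - 1 / p ^ k) := by
      intro k _
      rw [← mul_add]
      congr 1
      field_simp
      ring
    have hsum : (∑ k ∈ Finset.range (n + 1 + 1), T k) * (1 - 1 / p / p ^ n) =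
        ∑ k ∈ Finset.range (n + 1), (T k * ((1 - p ^ k / p ^ (n + 1)) / p ^ k) +
          T (k + 1) * (1 - 1 / p ^ (k + 1))) := by
      rw [Finset.sum_mul, Finset.sum_congr rfl hsplit, Finset.sum_add_distrib,
        Finset.sum_range_succ, Finset.sum_range_succ' (fun k => T k * (1 - 1 / p ^ k)),
        Finset.sum_add_distrib]
      simp [div_self (pow_ne_zero (n + 1) hp0.ne')]
    -- The two pieces share a factor and carry the weights `1 - x / p ^ k` and `x / p ^ k`, which
    -- add up to one. What is left is the summand for `n` and `x / p`.
    have hterm : ∀ k ∈ Finset.range (n + 1), T k * ((1 - p ^ k / p ^ (n + 1)) / p ^ k) +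
          T (k + 1) * (1 - 1 / p ^ (k + 1)) = (x / p) ^ k * p ^ k / p ^ k ^ 2 /
        (poch p (1 / p) k * poch p (1 / p) (n - k) * poch p (x / p) k) / (1 - x) := by
      intro k hk
      obtain ⟨m, rfl⟩ : ∃ m, n = k + m := ⟨n - k, by simp at hk; omega⟩
      have e1 : k + m + 1 - k = m + 1 := by omega
      have e2 : k + m + 1 - (k + 1) = m := by omega
      have e3 : k + m - k = m := by omega
      simp only [hT, e1, e2, e3]
      have hx := poch_succ' p x k
      rw [poch_succ p (1 / p) m, poch_succ p (1 / p) k, hx]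
      rw [poch_succ] at hx
      have ha := (poch_inv_pos hp k).ne'
      have hb := (poch_inv_pos hp m).ne'
      have hc := (poch_pos hp hx0 hx1 k).ne'
      have hd := (poch_pos hp h0 h1 k).ne'
      have f1 : 1 - 1 / p / p ^ m ≠ 0 := (one_sub_div_pow_pos hp (by positivity)
        ((div_lt_one hp0).2 hp) m).ne'
      have f2 : 1 - 1 / p / p ^ k ≠ 0 := (one_sub_div_pow_pos hp (by positivity)
        ((div_lt_one hp0).2 hp) k).ne'
      have f3 : 1 - x ≠ 0 := by linarith
      have g1 : 1 - p ^ k / p ^ (k + m + 1) = 1 - 1 / p / p ^ m := by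
        field_simp
        ring
      have g2 : 1 - 1 / p ^ (k + 1) = 1 - 1 / p / p ^ k := by
        rw [div_div, ← pow_succ']
      rw [g1, g2]
      generalize 1 - 1 / p / p ^ m = A at *
      generalize 1 - 1 / p / p ^ k = B at *
      generalize poch p (1 / p) k = a at *
      generalize poch p (1 / p) m = b at *
      generalize poch p (x / p) k = c at *
      generalize poch p x k = e at *
      have t1 : x ^ k * p ^ k / p ^ k ^ 2 / (a * (b * A) * e) * (A / p ^ k) =
          x ^ k / p ^ k ^ 2 / (a * b * ((1 - x) * c)) * (1 - x / p ^ k) := by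
        rw [← hx]
        have f4 : 1 - x / p ^ k ≠ 0 := (one_sub_div_pow_pos hp h0 h1 k).ne'
        generalize 1 - x / p ^ k = D at *
        field_simp
      have t2 : x ^ (k + 1) * p ^ (k + 1) / p ^ (k + 1) ^ 2 / (a * B * b * ((1 - x) * c)) * B =
          x ^ k / p ^ k ^ 2 / (a * b * ((1 - x) * c)) * (x / p ^ k) := by
        have : (k + 1) ^ 2 = k ^ 2 + (k + (k + 1)) := by ring
        rw [this]
        simp only [pow_add]
        field_simp
      rw [t1, t2, ← mul_add, sub_add_cancel, mul_one, div_pow,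
        div_mul_cancel₀ _ (pow_ne_zero k hp0.ne')]
      simp only [div_eq_mul_inv, mul_inv]
      ring
    rw [Finset.sum_congr rfl hterm, ← Finset.sum_div, ih hx0 hx1] at hsum
    rw [← eq_div_iff hq.ne'] at hsum
    rw [hsum, poch_succ, poch_succ' p x n, div_div, div_div]
    congr 1
    ring

theorem autCard_pos {p : ℝ} (hp : 1 < p) (lam : YoungDiagram) : 0 < autCard p lam := by
  rw [autCard_eq_prod]
  exact Finset.prod_pos fun j _ => mul_pos (by positivity) (poch_inv_pos hp _)

/-- Each factor `p ^ b - p ^ j` is `p ^ b` times `1 - p^{-(b-j)}`, which is a factor of the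
Pochhammer product of length `b - j`. -/
theorem poch_mul_prod_Ico {p : ℝ} (hp : 1 < p) {r m b : ℕ} (hr : r ≤ m) (hm : m ≤ b) :
    poch p (1 / p) (b - m) * ∏ j ∈ Finset.Ico r m, (p ^ b - p ^ j) =
      p ^ (b * (m - r)) * poch p (1 / p) (b - r) := by
  have hp0 : 0 < p := by linarith
  induction m, hr using Nat.le_induction with
  | base => simp
  | succ m hr ih =>
    rw [Finset.prod_Ico_succ_top hr, show m + 1 - r = m - r + 1 by omega, mul_add, pow_add, mul_one]
    have ih := ih (by omega)
    rw [show b - m = b - (m + 1) + 1 by omega, poch_succ] at ih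
    have : p ^ b - p ^ m = p ^ b * (1 - 1 / p / p ^ (b - (m + 1))) := by
      have : p ^ b = p ^ m * p * p ^ (b - (m + 1)) := by
        rw [← pow_succ, ← pow_add]
        congr 1
        omega
      rw [this]
      field_simp
    rw [this]
    linear_combination p ^ b * ih

/-- Both sides obey the same recursion under adding a first column. -/
theorem aeval_injPoly_self {p : ℝ} (hp : 1 < p) (mu : YoungDiagram) :
    aeval p (injPoly mu mu) = autCard p mu := by
  refine addCol_induction (P := fun mu => aeval p (injPoly mu mu) = autCard p mu)
    (by simp [injPoly_bot, autCard_bot]) (fun b nu _ hb ih => ?_) mu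
  have h := poch_mul_prod_Ico hp hb le_rfl
  rw [Nat.sub_self, poch_zero, one_mul] at h
  rw [injPoly_addCol hb hb, autCard_addCol p hb]
  simp only [map_mul, map_pow, aeval_X, map_prod, map_sub, ih, h]
  have : b ^ 2 = b * nu.colLen 0 + b * (b - nu.colLen 0) := by
    rw [← mul_add, Nat.add_sub_cancel' hb, sq]
  rw [this, pow_add]
  ring

/-! ### Summation over partitions by the length of the first column. -/

/-- The part of the mass of `lam` that depends on `lam`. -/
noncomputable def chainWeight (p u : ℝ) (d : ℕ) (lam : YoungDiagram) : ℝ :=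
  if lam.colLen 0 ≤ d then u ^ lam.card / autCard p lam / poch p (1 / p) (d - lam.colLen 0) else 0

theorem massP_eq {p : ℝ} (hp : 1 < p) (u : ℝ) (d : ℕ) (lam : YoungDiagram) :
    massP p u d lam = poch p (u / p) d * poch p (1 / p) d * chainWeight p u d lam := by
  have hI : ∀ a, Finset.Icc (a + 1) d = Finset.Ico (a + 1) (d + 1) := fun a => by
    ext; simp only [Finset.mem_Icc, Finset.mem_Ico]; omega
  have hp0 : 0 < p := by linarith
  rw [massP, chainWeight, numParts_eq]
  split_ifs with h
  · have e1 : ∏ i ∈ Finset.Icc 1 d, (1 - u / p ^ i) = poch p (u / p) d := by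
      rw [← zero_add 1, hI, Finset.prod_Ico_eq_prod_range, poch]
      simp [pow_add, div_div]
    have e2 : ∏ i ∈ Finset.Icc (d - lam.colLen 0 + 1) d, (1 - 1 / p ^ i) =
        poch p (1 / p) d / poch p (1 / p) (d - lam.colLen 0) := by
      have hh : ∀ x, 1 - 1 / p ^ (x + 1) = 1 - 1 / p / p ^ x := fun x => by
        rw [div_div, ← pow_succ']
      rw [eq_div_iff (poch_inv_pos hp _).ne', hI, ← Finset.prod_Ico_add', mul_comm]
      simp only [hh]
      exact Finset.prod_range_mul_prod_Ico _ (Nat.sub_le d (lam.colLen 0))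
    rw [e1, e2]
    ring
  · simp

theorem chainWeight_nonneg {p u : ℝ} (hp : 1 < p) (hu : 0 < u) (d : ℕ) (lam : YoungDiagram) :
    0 ≤ chainWeight p u d lam := by
  rw [chainWeight]
  split_ifs
  · exact div_nonneg (div_nonneg (by positivity) (autCard_pos hp _).le) (poch_inv_pos hp _).le
  · exact le_rfl

/-- The factor `poch p (1 / p) (b - nu.colLen 0)` contributed to `autCard` by the new column is
exactly the normalisation of the weight of `nu` with bound `b`, so the recursion closes up. -/
theorem chainWeight_addCol (p u : ℝ) {b d : ℕ} (hd : b ≤ d) (nu : YoungDiagram) :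
    (if nu.colLen 0 ≤ b then chainWeight p u d (addCol b nu) else 0) =
      u ^ b / p ^ b ^ 2 / poch p (1 / p) (d - b) * chainWeight p u b nu := by
  rw [chainWeight, chainWeight, colLen_addCol_zero, if_pos hd]
  split_ifs with h
  · rw [card_addCol h, autCard_addCol p h, pow_add]
    simp only [div_eq_mul_inv, mul_inv]
    ring
  · simp

theorem HasSum.congr_eq {ι : Type*} {f g : ι → ℝ} {a b : ℝ} (h : HasSum f a)
    (hfg : ∀ x, g x = f x) (hab : b = a) : HasSum g b := by
  rw [funext hfg, hab]
  exact h

/-- Summation over all partitions, sorted by the first column. -/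
theorem hasSum_of_addCol {f : YoungDiagram → ℝ} {d : ℕ}
    (hf : ∀ lam : YoungDiagram, d < lam.colLen 0 → f lam = 0) {a : ℕ → ℝ}
    (h : ∀ b ≤ d, HasSum (fun nu : YoungDiagram => if nu.colLen 0 ≤ b then f (addCol b nu) else 0)
      (a b)) :
    HasSum f (∑ b ∈ Finset.range (d + 1), a b) := by
  -- Pairs (first column length, remaining diagram) encode partitions injectively, and `g` is zero
  -- on the pairs that encode none. The sum thus becomes one over all pairs, taken for each `b`
  -- separately.
  let g : ℕ × YoungDiagram → ℝ := fun x => if x.2.colLen 0 ≤ x.1 then f (addCol x.1 x.2) else 0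
  have hinj : Function.Injective fun lam : YoungDiagram => (lam.colLen 0, lam.removeCol) := by
    intro lam mu hlm
    simp only [Prod.mk.injEq] at hlm
    rw [← addCol_removeCol lam, ← addCol_removeCol mu, hlm.1, hlm.2]
  have hg : HasSum (g ∘ fun lam : YoungDiagram => (lam.colLen 0, lam.removeCol))
      (∑ b ∈ Finset.range (d + 1), a b) := by
    rw [hinj.hasSum_iff]
    · have hb : ∀ b ∈ Finset.range (d + 1),
          HasSum (fun x : ℕ × YoungDiagram => if x.1 = b then g x else 0) (a b) := by
        intro b hb
        rw [← (Prod.mk_right_injective b).hasSum_iff]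
        · simpa [Function.comp_def, g] using h b (by simpa [Nat.lt_succ_iff] using hb)
        · rintro ⟨c, nu⟩ hx
          simp only [Set.mem_range, Prod.mk.injEq, exists_eq_right] at hx
          exact if_neg fun hc => hx hc.symm
      convert hasSum_sum hb using 2 with x
      rw [Finset.sum_ite_eq]
      split_ifs with hx
      · rfl
      · simp only [g]
        split_ifs
        · exact hf _ (by rw [colLen_addCol_zero]; simpa using hx)
        · rfl
    · rintro ⟨b, nu⟩ hx
      refine if_neg fun hb => hx ⟨addCol b nu, ?_⟩
      simp only at hb
      simp only [colLen_addCol_zero, removeCol_addCol hb]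
  refine hg.congr_eq (fun lam => ?_) rfl
  simp [g, colLen_removeCol_le, addCol_removeCol]

/-- The proposed total weights solve the column recursion: this is `sum_durfee` at `x = u / p`. -/
theorem sum_chainWeight_total {p u : ℝ} (hp : 1 < p) (hu : 0 < u) (hup : u < p) (d : ℕ) :
    ∑ b ∈ Finset.range (d + 1), u ^ b / p ^ b ^ 2 / poch p (1 / p) (d - b) *
        (1 / (poch p (1 / p) b * poch p (u / p) b)) =
      1 / (poch p (1 / p) d * poch p (u / p) d) := by
  have hp0 : 0 < p := by linarith
  rw [← sum_durfee hp (by positivity) ((div_lt_one hp0).2 hup)]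
  refine Finset.sum_congr rfl fun b _ => ?_
  rw [div_pow, div_mul_cancel₀ _ (by positivity)]
  simp only [div_eq_mul_inv, mul_inv]
  ring

-- Bounding the number of columns by `L` makes the column recursion an induction on `L`. The bound
-- on the sum does not depend on `L`, which yields summability of the full series.
open Classical in
theorem exists_hasSum_chainWeight_truncated {p u : ℝ} (hp : 1 < p) (hu : 0 < u) (hup : u < p)
    (L d : ℕ) : ∃ s ≤ 1 / (poch p (1 / p) d * poch p (u / p) d),
      HasSum (fun lam : YoungDiagram => if lam.rowLen 0 ≤ L then chainWeight p u d lam else 0) s := by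
  have hp0 : 0 < p := by linarith
  have hx0 : 0 ≤ u / p := by positivity
  have hx1 : u / p < 1 := (div_lt_one hp0).2 hup
  induction L generalizing d with
  | zero =>
    refine ⟨chainWeight p u d ⊥, ?_, ?_⟩
    · rw [chainWeight, colLen_bot, if_pos (Nat.zero_le d), autCard_bot]
      have h1 := poch_inv_pos hp d
      have h2 := poch_pos hp hx0 hx1 d
      have h3 := poch_le_one hp hx0 hx1 d
      simp only [YoungDiagram.card, cells_bot, Finset.card_empty, pow_zero, Nat.sub_zero, div_one]
      exact one_div_le_one_div_of_le (by positivity) (mul_le_of_le_one_right h1.le h3)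
    · refine (hasSum_ite_eq (⊥ : YoungDiagram) (chainWeight p u d ⊥)).congr_eq (fun lam => ?_) rfl
      by_cases h : lam = ⊥
      · rw [if_pos h, if_pos (by rw [h, rowLen_bot]), h]
      · rw [if_neg h, if_neg (by rwa [Nat.le_zero, ← eq_bot_iff_rowLen])]
  | succ L ih =>
    choose s hs hsum using ih
    refine ⟨∑ b ∈ Finset.range (d + 1), u ^ b / p ^ b ^ 2 / poch p (1 / p) (d - b) * s b,
      ?_, hasSum_of_addCol ?_ fun b hb => ?_⟩
    · rw [← sum_chainWeight_total hp hu hup]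
      refine Finset.sum_le_sum fun b _ => mul_le_mul_of_nonneg_left (hs b) ?_
      have := poch_inv_pos hp (d - b)
      positivity
    · intro lam h
      rw [chainWeight, if_neg (not_le.2 h), ite_self]
    · refine ((hsum b).mul_left (u ^ b / p ^ b ^ 2 / poch p (1 / p) (d - b))).congr_eq
        (fun nu => ?_) rfl
      have h1 := chainWeight_addCol p u hb nu
      by_cases hnu : nu.colLen 0 ≤ b
      · rw [if_pos hnu] at h1 ⊢
        -- For `b = 0` no row gets longer, but then both diagrams are empty.
        have h2 : (addCol b nu).rowLen 0 ≤ L + 1 ↔ nu.rowLen 0 ≤ L := by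
          rcases Nat.eq_zero_or_pos b with rfl | hb0
          · have h3 : nu = ⊥ := eq_bot_iff_colLen.2 (by omega)
            have h4 : addCol 0 nu = ⊥ := eq_bot_iff_colLen.2 (colLen_addCol_zero _ _)
            rw [h4, h3, rowLen_bot]
            simp
          · rw [rowLen_addCol hb0]
            omega
        simp only [h2, h1, mul_ite, mul_zero]
      · rw [if_neg hnu] at h1 ⊢
        rw [mul_ite, mul_zero, ← h1, ite_self]

theorem hasSum_chainWeight {p u : ℝ} (hp : 1 < p) (hu : 0 < u) (hup : u < p) (d : ℕ) :
    HasSum (chainWeight p u d) (1 / (poch p (1 / p) d * poch p (u / p) d)) := by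
  have hp0 : 0 < p := by linarith
  have hsum : ∀ d, Summable (chainWeight p u d) := by
    intro d
    refine summable_of_sum_le (chainWeight_nonneg hp hu d)
      (c := 1 / (poch p (1 / p) d * poch p (u / p) d)) fun s => ?_
    -- A finite set of partitions is contained in the truncation at its largest part.
    obtain ⟨t, ht, hst⟩ := exists_hasSum_chainWeight_truncated hp hu hup
      (s.sup fun lam => lam.rowLen 0) d
    refine le_trans (le_of_eq ?_) ((sum_le_hasSum s (fun lam _ => ?_) hst).trans ht)
    · exact Finset.sum_congr rfl fun lam hlam =>
        (if_pos (Finset.le_sup (f := fun lam : YoungDiagram => lam.rowLen 0) hlam)).symm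
    · split_ifs
      · exact chainWeight_nonneg hp hu d lam
      · exact le_rfl
  have hrec : ∀ d, ∑' lam, chainWeight p u d lam = ∑ b ∈ Finset.range (d + 1),
      u ^ b / p ^ b ^ 2 / poch p (1 / p) (d - b) * ∑' lam, chainWeight p u b lam := by
    intro d
    refine (hasSum_of_addCol (fun lam h => ?_) fun b hb => ?_).tsum_eq
    · rw [chainWeight, if_neg (by omega)]
    · simp_rw [chainWeight_addCol p u hb]
      exact (hsum b).hasSum.mul_left _
  suffices h : ∀ d, ∑' lam, chainWeight p u d lam = 1 / (poch p (1 / p) d * poch p (u / p) d) by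
    rw [← h d]
    exact (hsum d).hasSum
  intro d
  induction d using Nat.strong_induction_on with
  | _ d ih =>
    -- The total for `d` occurs on both sides of its recursion, with coefficient `u ^ d / p ^ d ^ 2`
    -- on the right. This is below one for `d > 0`, so the equation can be solved; for `d = 0` it is
    -- vacuous, and only the empty partition has weight.
    rcases Nat.eq_zero_or_pos d with rfl | hd
    · rw [tsum_eq_single ⊥]
      · simp [chainWeight, colLen_bot, autCard_bot, poch_zero, YoungDiagram.card]
      · intro lam h
        rw [chainWeight, if_neg]
        rwa [Nat.le_zero, ← eq_bot_iff_colLen]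
    · have h1 := hrec d
      have h2 := sum_chainWeight_total hp hu hup d
      rw [Finset.sum_range_succ, Nat.sub_self, poch_zero, div_one] at h1 h2
      rw [Finset.sum_congr rfl fun b hb => by rw [ih b (Finset.mem_range.1 hb)]] at h1
      have h3 : u ^ d / p ^ d ^ 2 < 1 := by
        rw [div_lt_one (by positivity)]
        calc u ^ d < p ^ d := pow_lt_pow_left₀ hup hu.le hd.ne'
          _ ≤ p ^ d ^ 2 := pow_le_pow_right₀ hp.le (by nlinarith)
      have h4 : (1 - u ^ d / p ^ d ^ 2) * (∑' lam, chainWeight p u d lam -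
          1 / (poch p (1 / p) d * poch p (u / p) d)) = 0 := by
        linear_combination h1 + h2
      rcases mul_eq_zero.1 h4 with h5 | h5 <;> linarith

/-- The induction step of the moment computation, for a fixed first column. -/
theorem hasSum_chainWeight_mul_injPoly_addCol {p u : ℝ} (hp : 1 < p) {mu : YoungDiagram}
    {m b d : ℕ} (hmu : mu.colLen 0 ≤ m) (hb : b ≤ d)
    (ih : HasSum (fun lam => chainWeight p u b lam * aeval p (injPoly mu lam))
      (if mu.colLen 0 ≤ b then
        u ^ mu.card / (poch p (1 / p) (b - mu.colLen 0) * poch p (u / p) b) else 0)) :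
    HasSum (fun nu : YoungDiagram => if nu.colLen 0 ≤ b then
      chainWeight p u d (addCol b nu) * aeval p (injPoly (addCol m mu) (addCol b nu)) else 0)
      (if m ≤ b then u ^ b / p ^ b ^ 2 * p ^ (b * m) * u ^ mu.card /
        (poch p (1 / p) (d - b) * poch p (1 / p) (b - m) * poch p (u / p) b) else 0) := by
  have hp0 : 0 < p := by linarith
  refine (ih.mul_left (u ^ b / p ^ b ^ 2 / poch p (1 / p) (d - b) *
      p ^ (b * mu.colLen 0) * ∏ j ∈ Finset.Ico (mu.colLen 0) m, (p ^ b - p ^ j))).congr_eq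
    (fun nu => ?_) ?_
  · have h2 := chainWeight_addCol p u hb nu
    by_cases h : nu.colLen 0 ≤ b
    · rw [if_pos h] at h2 ⊢
      rw [h2, injPoly_addCol hmu h]
      simp only [map_mul, map_pow, aeval_X, map_prod, map_sub]
      generalize ∏ j ∈ Finset.Ico (mu.colLen 0) m, (p ^ b - p ^ j) = P
      ring
    · rw [if_neg h] at h2 ⊢
      generalize ∏ j ∈ Finset.Ico (mu.colLen 0) m, (p ^ b - p ^ j) = P
      linear_combination p ^ (b * mu.colLen 0) * P * aeval p (injPoly mu nu) * h2
  · by_cases hmb : m ≤ b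
    · rw [if_pos hmb, if_pos (hmu.trans hmb)]
      have h3 := poch_mul_prod_Ico hp hmu hmb
      have h4 : p ^ (b * m) = p ^ (b * mu.colLen 0) * p ^ (b * (m - mu.colLen 0)) := by
        rw [← pow_add, ← mul_add, Nat.add_sub_cancel' hmu]
      rw [h4]
      have k2 := (poch_inv_pos hp (b - m)).ne'
      have k3 := (poch_inv_pos hp (b - mu.colLen 0)).ne'
      have h5 : p ^ (b * (m - mu.colLen 0)) / poch p (1 / p) (b - m) =
          (∏ j ∈ Finset.Ico (mu.colLen 0) m, (p ^ b - p ^ j)) /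
            poch p (1 / p) (b - mu.colLen 0) := by
        rw [div_eq_div_iff k2 k3, ← h3, mul_comm]
      generalize ∏ j ∈ Finset.Ico (mu.colLen 0) m, (p ^ b - p ^ j) = P at *
      linear_combination u ^ b / p ^ b ^ 2 * p ^ (b * mu.colLen 0) * u ^ mu.card /
        (poch p (1 / p) (d - b) * poch p (u / p) b) * h5
    · rw [if_neg hmb]
      split_ifs with h
      -- For `mu.colLen 0 ≤ b < m` the product contains the zero factor `j = b`: no injection
      -- exists.
      · rw [Finset.prod_eq_zero (Finset.mem_Ico.2 ⟨h, not_le.1 hmb⟩) (sub_self _), mul_zero,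
          zero_mul]
      · rw [mul_zero]

/-- Writing `b = m + k` turns the sum into `sum_durfee` at `x = u / p ^ (m + 1)`. -/
theorem sum_chainWeight_total_shifted {p u : ℝ} (hp : 1 < p) (hu : 0 < u) (hup : u < p)
    (m n : ℕ) :
    ∑ b ∈ Finset.range (m + n + 1), (if m ≤ b then u ^ b / p ^ b ^ 2 * p ^ (b * m) /
        (poch p (1 / p) (m + n - b) * poch p (1 / p) (b - m) * poch p (u / p) b) else 0) =
      u ^ m / (poch p (1 / p) n * poch p (u / p) (m + n)) := by
  have hp0 : 0 < p := by linarith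
  have hx0 : 0 ≤ u / p := by positivity
  have hx1 : u / p < 1 := (div_lt_one hp0).2 hup
  rw [add_assoc, Finset.sum_range_add, Finset.sum_eq_zero, zero_add]
  · have hy0 : 0 ≤ u / p / p ^ m := by positivity
    have hy1 : u / p / p ^ m < 1 := (div_le_self hx0 (one_le_pow₀ hp.le)).trans_lt hx1
    have hd := sum_durfee hp hy0 hy1 n
    rw [poch_add]
    have e3 : u ^ m / (poch p (1 / p) n * (poch p (u / p) m * poch p (u / p / p ^ m) n)) =
        u ^ m / poch p (u / p) m * (1 / (poch p (1 / p) n * poch p (u / p / p ^ m) n)) := by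
      simp only [div_eq_mul_inv, mul_inv]
      ring
    rw [e3, ← hd, Finset.mul_sum]
    refine Finset.sum_congr rfl fun k hk => ?_
    have e1 : m + n - (m + k) = n - k := by omega
    rw [if_pos (Nat.le_add_right m k), Nat.add_sub_cancel_left, e1, poch_add]
    have e2 : u ^ (m + k) / p ^ (m + k) ^ 2 * p ^ ((m + k) * m) =
        u ^ m * ((u / p / p ^ m) ^ k * p ^ k / p ^ k ^ 2) := by
      rw [show (m + k) ^ 2 = (m + k) * m + (m * k + k ^ 2) by ring, pow_add p, pow_add p,
        div_pow, div_pow, ← pow_mul, pow_add u]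
      field_simp
    rw [e2]
    simp only [div_eq_mul_inv, mul_inv]
    ring
  · intro b hb
    exact if_neg (not_le.2 (Finset.mem_range.1 hb))

theorem hasSum_chainWeight_mul_injPoly {p u : ℝ} (hp : 1 < p) (hu : 0 < u) (hup : u < p)
    (mu : YoungDiagram) (d : ℕ) :
    HasSum (fun lam => chainWeight p u d lam * aeval p (injPoly mu lam))
      (if mu.colLen 0 ≤ d then
        u ^ mu.card / (poch p (1 / p) (d - mu.colLen 0) * poch p (u / p) d) else 0) := by
  induction mu using addCol_induction generalizing d with
  | bot => simpa [injPoly_bot, colLen_bot, YoungDiagram.card] using hasSum_chainWeight hp hu hup d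
  | step m mu hm hmu ih =>
    have htot := hasSum_of_addCol (f := fun lam => chainWeight p u d lam *
      aeval p (injPoly (addCol m mu) lam)) (fun lam (h : d < lam.colLen 0) => by
      rw [chainWeight, if_neg (not_le.2 h), zero_mul])
      fun b hb => hasSum_chainWeight_mul_injPoly_addCol hp hmu hb (ih b)
    refine htot.congr_eq (fun _ => rfl) ?_
    rw [colLen_addCol_zero, card_addCol hmu]
    split_ifs with hmd
    · obtain ⟨n, rfl⟩ : ∃ n, d = m + n := ⟨d - m, by omega⟩
      have h := congrArg (· * u ^ mu.card) (sum_chainWeight_total_shifted hp hu hup m n)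
      simp only [Finset.sum_mul, ite_mul, zero_mul] at h
      rw [Nat.add_sub_cancel_left, pow_add, mul_div_right_comm, ← h]
      refine Finset.sum_congr rfl fun b _ => ?_
      simp only [div_eq_mul_inv]
      congr 1
      ring
    · refine (Finset.sum_eq_zero fun b hb => if_neg ?_).symm
      rw [Finset.mem_range] at hb
      omega

/-! ### Extending injective homomorphisms by one cyclic factor. -/

section InjectiveHom

variable {H G : Type*} [AddCommGroup H] [AddCommGroup G]

/-- The injective homomorphisms from `H` to `G`. -/
abbrev InjHom (H G : Type*) [AddCommGroup H] [AddCommGroup G] : Type _ :=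
  {f : H →+ G // Function.Injective f}

/-- The elements of `G` killed by `n`. -/
abbrev NTorsion (G : Type*) [AddCommGroup G] (n : ℕ) : Type _ := {g : G // n • g = 0}

theorem card_injHom_congr {H' G' : Type*} [AddCommGroup H'] [AddCommGroup G'] (e : H ≃+ H')
    (e' : G ≃+ G') : Nat.card (InjHom H G) = Nat.card (InjHom H' G') := by
  refine Nat.card_congr
    { toFun := fun f => ⟨(e'.toAddMonoidHom.comp f.1).comp e.symm.toAddMonoidHom,
        (e'.injective.comp f.2).comp e.symm.injective⟩
      invFun := fun f => ⟨(e'.symm.toAddMonoidHom.comp f.1).comp e.toAddMonoidHom,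
        (e'.symm.injective.comp f.2).comp e.injective⟩
      left_inv := fun f => ?_
      right_inv := fun f => ?_ }
  · ext x
    simp
  · ext x
    simp

theorem card_torsion_congr {G' : Type*} [AddCommGroup G'] (e : G ≃+ G') (n : ℕ) :
    Nat.card (NTorsion G n) = Nat.card (NTorsion G' n) :=
  Nat.card_congr (e.toEquiv.subtypeEquiv fun g => by
    simp only [AddEquiv.toEquiv_eq_coe, EquivLike.coe_coe, ← map_nsmul,
      EmbeddingLike.map_eq_zero_iff])

theorem card_torsion_prod (n : ℕ) :
    Nat.card (NTorsion (H × G) n) = Nat.card (NTorsion H n) * Nat.card (NTorsion G n) := by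
  rw [← Nat.card_prod]
  exact Nat.card_congr
    { toFun := fun x => (⟨x.1.1, congrArg Prod.fst x.2⟩, ⟨x.1.2, congrArg Prod.snd x.2⟩)
      invFun := fun x => ⟨(x.1.1, x.2.1), Prod.ext x.1.2 x.2.2⟩
      left_inv := fun _ => rfl
      right_inv := fun _ => rfl }

/-- Multiplication by `q ^ e` sends these elements to the `q`-torsion of the image of `f`. By `hH`
it hits all of it, and the fibres are cosets of the `q ^ e`-torsion of `G`. -/
theorem card_nsmul_mem_range (f : H →+ G) (hf : Function.Injective f) {q e : ℕ}
    (hH : ∀ h : H, q • h = 0 → ∃ k : H, q ^ e • k = h) :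
    Nat.card {g : G // q ^ (e + 1) • g = 0 ∧ q ^ e • g ∈ f.range} =
      Nat.card (NTorsion H q) * Nat.card (NTorsion G (q ^ e)) := by
  choose s hs using hH
  rw [← Nat.card_prod]
  symm
  have hval : ∀ (h : H) (h0 : q • h = 0) (x : G), q ^ e • x = 0 →
      q ^ e • (f (s h h0) + x) = f h := fun h h0 x hx => by
    rw [smul_add, hx, add_zero, ← map_nsmul, hs]
  refine Nat.card_congr (Equiv.ofBijective
    (fun x : NTorsion H q × NTorsion G (q ^ e) =>
      ⟨f (s x.1.1 x.1.2) + x.2.1, ?_, ?_⟩) ⟨?_, ?_⟩)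
  · rw [pow_succ', mul_smul, hval _ _ _ x.2.2, ← map_nsmul, x.1.2, map_zero]
  · rw [hval _ _ _ x.2.2]
    exact ⟨_, rfl⟩
  · rintro ⟨⟨h, h0⟩, ⟨x, hx⟩⟩ ⟨⟨h', h0'⟩, ⟨x', hx'⟩⟩ heq
    simp only [Subtype.mk.injEq] at heq
    have h1 := congrArg (q ^ e • ·) heq
    simp only [hval _ _ _ hx, hval _ _ _ hx'] at h1
    obtain rfl := hf h1
    simpa using heq
  · rintro ⟨g, hg, h, hh⟩
    have h0 : q • h = 0 := hf (by rw [map_nsmul, hh, ← mul_smul, ← pow_succ', hg, map_zero])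
    refine ⟨⟨⟨h, h0⟩, ⟨g - f (s h h0), ?_⟩⟩, ?_⟩
    · rw [smul_sub, ← hh, ← map_nsmul, hs, sub_self]
    · simp

theorem injective_coprod_zmod_lift {f : H →+ G} (hf : Function.Injective f) {q e : ℕ}
    (hq : q.Prime) {g : G} (φ : H × ZMod (q ^ (e + 1)) →+ G) (hφ : ∀ h, φ (h, 0) = f h)
    (hg : φ (0, 1) = g) (hr : q ^ e • g ∉ f.range) : Function.Injective φ := by
  rw [injective_iff_map_eq_zero]
  rintro ⟨h, z⟩ hz
  obtain ⟨c, rfl⟩ := ZMod.intCast_surjective z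
  have hsplit : φ (h, (c : ZMod (q ^ (e + 1)))) = f h + c • g := by
    rw [← hφ, ← hg, ← map_zsmul, ← map_add]
    simp
  have hmem : c • g ∈ f.range := by
    rw [hsplit] at hz
    exact ⟨-h, by rw [map_neg, neg_eq_iff_add_eq_zero, hz]⟩
  have hg0 : q ^ (e + 1) • g = 0 := by
    rw [← hg, ← map_nsmul]
    simp [-Nat.cast_pow, Prod.mk_zero_zero]
  -- The gcd of `c` and `q ^ (e + 1)` is some `q ^ a`. If `a ≤ e`, Bézout puts `q ^ a • g`, hence `q
  -- ^ e • g`, into the range of `f`, against `hr`.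
  have hdvd : ((q ^ (e + 1) : ℕ) : ℤ) ∣ c := by
    obtain ⟨a, ha, hgcd⟩ := (Nat.dvd_prime_pow hq).1
      (Int.gcd_dvd_natAbs_right c ((q ^ (e + 1) : ℕ) : ℤ))
    rcases Nat.lt_or_ge a (e + 1) with hlt | hge
    · exfalso
      apply hr
      have hb := Int.gcd_eq_gcd_ab c ((q ^ (e + 1) : ℕ) : ℤ)
      have h1 : q ^ a • g ∈ f.range := by
        rw [← natCast_zsmul, ← hgcd, hb, add_smul, mul_comm, mul_smul, mul_comm, mul_smul,
          natCast_zsmul, hg0, smul_zero, add_zero]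
        exact f.range.zsmul_mem hmem _
      obtain ⟨k, rfl⟩ : ∃ k, e = k + a := ⟨e - a, by omega⟩
      rw [pow_add, mul_smul]
      exact f.range.nsmul_mem h1 _
    · have : a = e + 1 := by omega
      rw [← this, ← hgcd]
      exact Int.gcd_dvd_left _ _
  have hc : (c : ZMod (q ^ (e + 1))) = 0 := (ZMod.intCast_zmod_eq_zero_iff_dvd c _).2 hdvd
  rw [hc, hφ] at hz
  rw [hc, hf (hz.trans (map_zero f).symm)]
  rfl

/-- Injective homomorphisms from `H × ℤ/q^(e+1)`, sorted by their restriction to `H`. -/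
theorem card_injHom_prod_zmod_eq_sigma {q : ℕ} (hq : q.Prime) (e : ℕ) :
    Nat.card (InjHom (H × ZMod (q ^ (e + 1))) G) =
      Nat.card (Σ f : InjHom H G, {g : G // q ^ (e + 1) • g = 0 ∧ q ^ e • g ∉ f.1.range}) := by
  have h1 : q ^ (e + 1) • ((0, 1) : H × ZMod (q ^ (e + 1))) = 0 := by
    simp [-Nat.cast_pow, Prod.mk_zero_zero]
  refine Nat.card_congr (Equiv.ofBijective (fun φ => ⟨⟨φ.1.comp (AddMonoidHom.inl _ _), ?_⟩,
    ⟨φ.1 (0, 1), ?_, ?_⟩⟩) ⟨?_, ?_⟩)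
  · exact φ.2.comp fun x y h => congrArg Prod.fst h
  · rw [← map_nsmul, h1, map_zero]
  · rintro ⟨h, hh⟩
    rw [← map_nsmul] at hh
    have h2 := congrArg Prod.snd (φ.2 hh)
    simp only [AddMonoidHom.inl_apply, Prod.smul_snd, nsmul_eq_mul, mul_one] at h2
    have h3 := (ZMod.natCast_eq_zero_iff _ _).1 h2.symm
    exact absurd (Nat.pow_dvd_pow_iff_le_right hq.one_lt |>.1 h3) (by omega)
  · rintro ⟨φ, hφ⟩ ⟨ψ, hψ⟩ h
    have ha : φ.comp (AddMonoidHom.inl _ _) = ψ.comp (AddMonoidHom.inl _ _) :=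
      congrArg (fun x => x.1.1) h
    have hb : φ (0, 1) = ψ (0, 1) := congrArg (fun x => x.2.1) h
    refine Subtype.ext (AddMonoidHom.ext fun ⟨h, z⟩ => ?_)
    obtain ⟨c, rfl⟩ := ZMod.intCast_surjective z
    have h4 : ((h, (c : ZMod (q ^ (e + 1)))) : H × ZMod (q ^ (e + 1))) = (h, 0) + c • (0, 1) := by
      simp
    simp only [h4, map_add, map_zsmul, hb]
    congr 1
    exact DFunLike.congr_fun ha h
  · rintro ⟨⟨f, hf⟩, ⟨g, hg, hr⟩⟩
    have hg' : zmultiplesHom G g ((q ^ (e + 1) : ℕ) : ℤ) = 0 := by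
      rw [zmultiplesHom_apply, natCast_zsmul, hg]
    let ψ : ZMod (q ^ (e + 1)) →+ G := ZMod.lift _ ⟨zmultiplesHom G g, hg'⟩
    have hψ : ψ 1 = g := by
      simpa using ZMod.lift_coe (q ^ (e + 1)) ⟨zmultiplesHom G g, hg'⟩ 1
    have k1 : ∀ h, f.coprod ψ (h, 0) = f h := fun h => by simp
    have k2 : f.coprod ψ (0, 1) = g := by simp [hψ]
    refine ⟨⟨f.coprod ψ, injective_coprod_zmod_lift hf hq _ k1 k2 hr⟩, ?_⟩
    exact Sigma.subtype_ext (Subtype.ext (AddMonoidHom.ext k1)) k2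

/-- Every injection of `H` has the same number of extensions: the admissible images of the new
generator are the `q ^ (e + 1)`-torsion minus the set counted in `card_nsmul_mem_range`. The
additive form avoids truncated subtraction. -/
theorem card_injHom_prod_zmod [Finite H] [Finite G] {q : ℕ} (hq : q.Prime) {e : ℕ}
    (hH : ∀ h : H, q • h = 0 → ∃ k : H, q ^ e • k = h) :
    Nat.card (InjHom (H × ZMod (q ^ (e + 1))) G) +
        Nat.card (InjHom H G) * (Nat.card (NTorsion H q) * Nat.card (NTorsion G (q ^ e))) =
      Nat.card (InjHom H G) * Nat.card (NTorsion G (q ^ (e + 1))) := by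
  classical
  have : Finite (H →+ G) := DFunLike.finite _
  have := Fintype.ofFinite (InjHom H G)
  have key : ∀ f : InjHom H G,
      Nat.card {g : G // q ^ (e + 1) • g = 0 ∧ q ^ e • g ∉ f.1.range} +
        Nat.card (NTorsion H q) * Nat.card (NTorsion G (q ^ e)) =
      Nat.card (NTorsion G (q ^ (e + 1))) := by
    intro f
    rw [← card_nsmul_mem_range f.1 f.2 hH, ← Nat.card_sum]
    refine Nat.card_congr (Equiv.trans (Equiv.sumComm _ _) (Equiv.trans ?_
      (Equiv.sumCompl fun x : NTorsion G (q ^ (e + 1)) => q ^ e • x.1 ∈ f.1.range)))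
    exact Equiv.sumCongr (Equiv.subtypeSubtypeEquivSubtypeInter _ _).symm
      (Equiv.subtypeSubtypeEquivSubtypeInter (fun g : G => q ^ (e + 1) • g = 0)
        fun g => q ^ e • g ∉ f.1.range).symm
  rw [card_injHom_prod_zmod_eq_sigma hq, Nat.card_sigma, Nat.card_eq_fintype_card (α := InjHom H G),
    ← Finset.card_univ, ← smul_eq_mul, ← smul_eq_mul (Finset.card _) (Nat.card (NTorsion G _)),
    ← Finset.sum_const, ← Finset.sum_const, ← Finset.sum_add_distrib]
  exact Finset.sum_congr rfl fun f _ => key f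

end InjectiveHom

/-! ### Injections between finite abelian groups of given types. -/

/-- The product of the `ℤ / q ^ e i` for `i < r`. -/
abbrev SeqGroup (q : ℕ) (e : ℕ → ℕ) (r : ℕ) : Type := (i : Fin r) → ZMod (q ^ e i)

/-- Splitting off the last factor. -/
noncomputable def seqGroupSuccEquiv (q : ℕ) (e : ℕ → ℕ) (r : ℕ) :
    SeqGroup q e (r + 1) ≃+ SeqGroup q e r × ZMod (q ^ e r) :=
  AddEquiv.ofBijective
    ({ toFun := fun f => (fun i => f i.castSucc, f (Fin.last r))
       map_zero' := rfl
       map_add' := fun _ _ => rfl } : SeqGroup q e (r + 1) →+ SeqGroup q e r × ZMod (q ^ e r))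
    ⟨fun f g h => by
      simp only [AddMonoidHom.coe_mk, ZeroHom.coe_mk, Prod.mk.injEq] at h
      funext i
      exact Fin.lastCases (motive := fun i => f i = g i) h.2 (fun i => congrFun h.1 i) i,
    fun x => ⟨Fin.snoc (α := fun i : Fin (r + 1) => ZMod (q ^ e i)) x.1 x.2, by
      refine Prod.ext (funext fun i => ?_) ?_
      · exact Fin.snoc_castSucc (α := fun i : Fin (r + 1) => ZMod (q ^ e i)) _ _ _
      · exact Fin.snoc_last (α := fun i : Fin (r + 1) => ZMod (q ^ e i)) _ _⟩⟩

theorem finite_seqGroup {q : ℕ} (hq : q.Prime) (e : ℕ → ℕ) (r : ℕ) : Finite (SeqGroup q e r) :=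
  have : ∀ i : Fin r, NeZero (q ^ e i) := fun _ => ⟨pow_ne_zero _ hq.ne_zero⟩
  inferInstance

theorem card_torsion_zmod {q : ℕ} (hq : q.Prime) (a k : ℕ) :
    Nat.card (NTorsion (ZMod (q ^ a)) (q ^ k)) = q ^ min a k := by
  have : NeZero (q ^ a) := ⟨pow_ne_zero _ hq.ne_zero⟩
  have h := IsAddCyclic.card_nsmulAddMonoidHom_ker (ZMod (q ^ a)) (q ^ k)
  rw [Nat.card_zmod] at h
  have hgcd : (q ^ a).gcd (q ^ k) = q ^ min a k := by
    rcases le_total a k with hak | hak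
    · rw [min_eq_left hak, Nat.gcd_eq_left (pow_dvd_pow q hak)]
    · rw [min_eq_right hak, Nat.gcd_eq_right (pow_dvd_pow q hak)]
  rw [← hgcd, ← h]
  rfl

theorem card_torsion_seqGroup {q : ℕ} (hq : q.Prime) (e : ℕ → ℕ) (r k : ℕ) :
    Nat.card (NTorsion (SeqGroup q e r) (q ^ k)) = q ^ ∑ i ∈ Finset.range r, min (e i) k := by
  induction r with
  | zero =>
    rw [Finset.range_zero, Finset.sum_empty, pow_zero, Nat.card_eq_one_iff_unique]
    exact ⟨inferInstance, ⟨⟨0, smul_zero _⟩⟩⟩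
  | succ r ih =>
    rw [card_torsion_congr (seqGroupSuccEquiv q e r), card_torsion_prod, ih, card_torsion_zmod hq,
      Finset.sum_range_succ, pow_add]

theorem exists_nsmul_eq_of_torsion {q : ℕ} (hq : q.Prime) {e : ℕ → ℕ} {r c : ℕ}
    (hc : ∀ i < r, c + 1 ≤ e i) (h : SeqGroup q e r) (h0 : q • h = 0) :
    ∃ k : SeqGroup q e r, q ^ c • k = h := by
  suffices H : ∀ i : Fin r, ∃ k : ZMod (q ^ e i), q ^ c • k = h i by
    choose k hk using H
    exact ⟨k, funext hk⟩
  intro i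
  have h1 : q • h i = 0 := congrFun h0 i
  obtain ⟨m, hm⟩ := ZMod.intCast_surjective (h i)
  obtain ⟨a, ha⟩ : ∃ a, e i = a + 1 + c := ⟨e i - 1 - c, by have := hc i i.2; omega⟩
  rw [← hm, nsmul_eq_mul] at h1
  have h2 : ((q * m : ℤ) : ZMod (q ^ e i)) = 0 := by
    push_cast
    exact h1
  rw [ZMod.intCast_zmod_eq_zero_iff_dvd, ha, show a + 1 + c = (a + c) + 1 by ring, pow_succ'] at h2
  push_cast at h2
  obtain ⟨t, ht⟩ := Int.dvd_of_mul_dvd_mul_left (by exact_mod_cast hq.ne_zero) h2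
  refine ⟨((q : ℤ) ^ a * t : ℤ), ?_⟩
  rw [← hm, ht]
  push_cast
  rw [nsmul_eq_mul]
  push_cast
  ring

theorem card_injHom_seqGroup {q : ℕ} (hq : q.Prime) {G : Type*} [AddCommGroup G] [Finite G]
    {s : ℕ → ℕ} (hs : ∀ k, Nat.card (NTorsion G (q ^ k)) = q ^ s k) {e : ℕ → ℕ} (he : Antitone e)
    (r : ℕ) (hr : ∀ i < r, 0 < e i) :
    (Nat.card (InjHom (SeqGroup q e r) G) : ℤ) =
      ∏ j ∈ Finset.range r, ((q : ℤ) ^ s (e j) - (q : ℤ) ^ (j + s (e j - 1))) := by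
  induction r with
  | zero =>
    rw [Finset.range_zero, Finset.prod_empty, Nat.cast_eq_one, Nat.card_eq_one_iff_unique]
    refine ⟨⟨fun f g => Subtype.ext (AddMonoidHom.ext fun x => ?_)⟩,
      ⟨⟨0, Function.injective_of_subsingleton _⟩⟩⟩
    rw [Subsingleton.elim x 0, map_zero, map_zero]
  | succ r ih =>
    have := finite_seqGroup hq e r
    obtain ⟨c, hc⟩ : ∃ c, e r = c + 1 := ⟨e r - 1, by have := hr r (Nat.lt_succ_self r); omega⟩
    -- The exponents decrease, so every earlier factor has exponent at least `c + 1`, and its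
    -- `q`-torsion consists of multiples of `q ^ c`.
    have hdiv := exists_nsmul_eq_of_torsion hq (e := e) (r := r) (c := c) fun i hi => by
      rw [← hc]
      exact he hi.le
    have hcard := card_injHom_prod_zmod (G := G) hq hdiv
    have htor : Nat.card (NTorsion (SeqGroup q e r) q) = q ^ r := by
      have h := card_torsion_seqGroup hq e r 1
      rw [pow_one] at h
      rw [h]
      congr 1
      rw [Finset.sum_congr rfl fun i hi => min_eq_right (hr i (by simp at hi; omega))]
      simp
    rw [Finset.prod_range_succ, ← ih fun i hi => hr i (by omega),
      card_injHom_congr (seqGroupSuccEquiv q e r) (AddEquiv.refl G), hc, Nat.add_sub_cancel]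
    rw [htor, hs, hs, ← pow_add] at hcard
    have hcast := congrArg (Nat.cast : ℕ → ℤ) hcard
    push_cast at hcast
    linear_combination hcast

/-- The cells in the first `k` columns are counted by rows and by columns. -/
theorem sum_min_rowLen (lam : YoungDiagram) (k : ℕ) :
    ∑ i ∈ Finset.range (lam.colLen 0), min (lam.rowLen i) k =
      ∑ j ∈ Finset.range k, lam.colLen j := by
  induction k with
  | zero => simp
  | succ k ih =>
    have h : ∀ i, min (lam.rowLen i) (k + 1) =
        min (lam.rowLen i) k + if k < lam.rowLen i then 1 else 0 := fun i => by
      split_ifs <;> omega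
    rw [Finset.sum_range_succ, ← ih, Finset.sum_congr rfl fun i _ => h i, Finset.sum_add_distrib,
      ← Finset.card_filter]
    congr 1
    have : (Finset.range (lam.colLen 0)).filter (fun i => k < lam.rowLen i) =
        Finset.range (lam.colLen k) := by
      ext i
      have h3 := lam.colLen_anti 0 k (Nat.zero_le k)
      simp only [Finset.mem_filter, Finset.mem_range, lt_rowLen_iff_lt_colLen]
      omega
    rw [this, Finset.card_range]

theorem card_injHom_typeGroup {q : ℕ} (hq : q.Prime) (mu lam : YoungDiagram) :
    (Nat.card (InjHom (TypeGroup q mu) (TypeGroup q lam)) : ℤ) =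
      (injPoly mu lam).eval (q : ℤ) := by
  have := finite_seqGroup hq lam.rowLen (numParts lam)
  have h := card_injHom_seqGroup hq (G := TypeGroup q lam)
    (s := fun k => ∑ i ∈ Finset.range k, lam.colLen i) (fun k => by
      rw [card_torsion_seqGroup hq lam.rowLen (numParts lam), numParts_eq, sum_min_rowLen])
    (e := mu.rowLen) (fun i j hij => mu.rowLen_anti i j hij) (numParts mu) (fun i hi => by
      rwa [lt_rowLen_iff_lt_colLen, ← numParts_eq])
  rw [h, injPoly, numParts_eq, eval_prod]
  simp

/-- An injective homomorphism amounts to its range, together with an isomorphism onto it. -/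
theorem card_injHom_eq_mul {q : ℕ} (hq : q.Prime) (mu lam : YoungDiagram) :
    Nat.card (InjHom (TypeGroup q mu) (TypeGroup q lam)) =
      subgroupCount q lam mu * Nat.card (InjHom (TypeGroup q mu) (TypeGroup q mu)) := by
  have := finite_seqGroup hq lam.rowLen (numParts lam)
  have := finite_seqGroup hq mu.rowLen (numParts mu)
  have : Finite (TypeGroup q mu ≃+ TypeGroup q mu) := DFunLike.finite _
  have hself : Nat.card (InjHom (TypeGroup q mu) (TypeGroup q mu)) =
      Nat.card (TypeGroup q mu ≃+ TypeGroup q mu) :=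
    Nat.card_congr (Equiv.ofBijective
      (fun f => AddEquiv.ofBijective f.1 (Finite.injective_iff_bijective.1 f.2))
      ⟨fun f g h => Subtype.ext (AddMonoidHom.ext fun x => DFunLike.congr_fun h x),
        fun e => ⟨⟨e.toAddMonoidHom, e.injective⟩, by ext; rfl⟩⟩)
  have hsub : ∀ H : {H : AddSubgroup (TypeGroup q lam) // HasType q H mu},
      Nat.card (TypeGroup q mu ≃+ H.1) = Nat.card (TypeGroup q mu ≃+ TypeGroup q mu) := fun H => by
    obtain ⟨e⟩ := H.2
    exact Nat.card_congr
      { toFun := fun f => f.trans e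
        invFun := fun f => f.trans e.symm
        left_inv := fun f => by ext; simp
        right_inv := fun f => by ext; simp }
  have hsig : Nat.card (InjHom (TypeGroup q mu) (TypeGroup q lam)) =
      Nat.card (Σ H : {H : AddSubgroup (TypeGroup q lam) // HasType q H mu},
        (TypeGroup q mu ≃+ H.1)) := by
    symm
    refine Nat.card_congr (Equiv.ofBijective
      (fun x => ⟨x.1.1.subtype.comp x.2.toAddMonoidHom,
        Subtype.val_injective.comp x.2.injective⟩) ⟨?_, ?_⟩)
    · rintro ⟨⟨H, hH⟩, e⟩ ⟨⟨H', hH'⟩, e'⟩ h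
      have h1 : ∀ x, (e x : TypeGroup q lam) = e' x := fun x =>
        DFunLike.congr_fun (congrArg Subtype.val h) x
      obtain rfl : H = H' := by
        ext y
        constructor
        · intro hy
          obtain ⟨x, hx⟩ := e.surjective ⟨y, hy⟩
          have := h1 x
          rw [hx] at this
          simp only at this
          rw [this]
          exact (e' x).2
        · intro hy
          obtain ⟨x, hx⟩ := e'.surjective ⟨y, hy⟩
          have := h1 x
          rw [hx] at this
          simp only at this
          rw [← this]
          exact (e x).2
      congr 1
      ext x
      rw [h1]
    · rintro ⟨f, hf⟩
      exact ⟨⟨⟨f.range, ⟨(AddMonoidHom.ofInjective hf).symm⟩⟩, AddMonoidHom.ofInjective hf⟩, rfl⟩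
  have : Fintype {H : AddSubgroup (TypeGroup q lam) // HasType q H mu} := Fintype.ofFinite _
  rw [hsig, Nat.card_sigma, Finset.sum_congr rfl fun H _ => hsub H, hself, subgroupCount,
    Finset.sum_const, Finset.card_univ, smul_eq_mul,
    Nat.card_eq_fintype_card (α := {H : AddSubgroup (TypeGroup q lam) // HasType q H mu})]

/-! ### From counts at primes to polynomials. -/

theorem eval_injPoly_self_pos {q : ℕ} (hq : q.Prime) (mu : YoungDiagram) :
    0 < (injPoly mu mu).eval (q : ℤ) := by
  have := finite_seqGroup hq mu.rowLen (numParts mu)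
  have : Finite (TypeGroup q mu →+ TypeGroup q mu) := DFunLike.finite _
  rw [← card_injHom_typeGroup hq, Nat.cast_pos]
  have : Nonempty (InjHom (TypeGroup q mu) (TypeGroup q mu)) :=
    ⟨⟨AddMonoidHom.id _, Function.injective_id⟩⟩
  exact Nat.card_pos

theorem eval_injPoly_eq {q : ℕ} (hq : q.Prime) (mu lam : YoungDiagram) :
    (injPoly mu lam).eval (q : ℤ) =
      (subgroupCount q lam mu : ℤ) * (injPoly mu mu).eval (q : ℤ) := by
  rw [← card_injHom_typeGroup hq, ← card_injHom_typeGroup hq, card_injHom_eq_mul hq, Nat.cast_mul]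

/-- A monic polynomial that divides an integer polynomial at infinitely many natural numbers
divides it. -/
theorem dvd_of_infinite_eval_dvd {N D : ℤ[X]} (hD : D.Monic) {S : Set ℕ} (hS : S.Infinite)
    (h : ∀ n ∈ S, D.eval (n : ℤ) ∣ N.eval (n : ℤ)) : D ∣ N := by
  rw [← modByMonic_eq_zero_iff_dvd hD]
  set R := N %ₘ D with hR
  have hdvd : ∀ n ∈ S, D.eval (n : ℤ) ∣ R.eval (n : ℤ) := fun n hn => by
    have h1 := congrArg (eval (n : ℤ)) (modByMonic_add_div N D)
    rw [eval_add, eval_mul, ← hR] at h1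
    exact (Int.dvd_add_left (dvd_mul_right _ _)).1 (h1 ▸ h n hn)
  -- Since `R` has smaller degree than `D`, the quotient of their values tends to zero. On `S` it is
  -- an integer, so `R` vanishes at all large elements of `S`.
  have hinj : Function.Injective (Int.castRingHom ℝ) := Int.cast_injective
  have hlim := Polynomial.div_tendsto_atTop_zero_of_degree_lt (R.map (Int.castRingHom ℝ))
    (D.map (Int.castRingHom ℝ)) (by
      rw [degree_map_eq_of_injective hinj, degree_map_eq_of_injective hinj]
      exact degree_modByMonic_lt N hD)
  have hlim' := hlim.comp (tendsto_natCast_atTop_atTop (R := ℝ))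
  obtain ⟨n₀, hn₀⟩ := Filter.eventually_atTop.1 (hlim'.eventually (Metric.ball_mem_nhds 0 one_pos))
  obtain ⟨n₁, hn₁⟩ := Filter.eventually_atTop.1 ((tendsto_natCast_atTop_atTop (R := ℝ)).eventually
    (Polynomial.eventually_atTop_not_isRoot (D.map (Int.castRingHom ℝ)) (hD.map _).ne_zero))
  have hzero : ∀ n ∈ S, max n₀ n₁ ≤ n → R.IsRoot (n : ℤ) := by
    intro n hn hle
    have h1 := hn₀ n (le_of_max_le_left hle)
    have h2 := hn₁ n (le_of_max_le_right hle)
    have e : ∀ P : ℤ[X], (P.map (Int.castRingHom ℝ)).eval (n : ℝ) = ((P.eval (n : ℤ) : ℤ) : ℝ) := by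
      intro P
      simp
    simp only [Function.comp_apply, e, IsRoot] at h1 h2
    obtain ⟨c, hc⟩ := hdvd n hn
    rw [hc, Int.cast_mul, mul_div_cancel_left₀ _ h2] at h1
    have h3 : c = 0 := by
      rw [dist_zero_right, Real.norm_eq_abs] at h1
      exact Int.abs_lt_one_iff.1 (by exact_mod_cast h1)
    rw [IsRoot, hc, h3, mul_zero]
  refine eq_zero_of_infinite_isRoot R
    (((hS.sdiff (Set.finite_Iio (max n₀ n₁))).image (f := fun n : ℕ => (n : ℤ))
      Nat.cast_injective.injOn).mono ?_)
  rintro _ ⟨n, ⟨hn, hle⟩, rfl⟩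
  exact hzero n hn (by simpa using hle)

theorem exists_isSubgroupPoly (lam mu : YoungDiagram) :
    ∃ f : ℤ[X], IsSubgroupPoly lam mu f ∧ injPoly mu lam = f * injPoly mu mu := by
  obtain ⟨f, hf⟩ := dvd_of_infinite_eval_dvd (N := injPoly mu lam) (injPoly_self_monic mu)
    Nat.infinite_setOfPred_prime fun q hq => ⟨_, (eval_injPoly_eq hq mu lam).trans (mul_comm _ _)⟩
  refine ⟨f, fun q hq => ?_, hf.trans (mul_comm _ _)⟩
  have h := eval_injPoly_eq hq mu lam
  rw [hf, eval_mul, mul_comm] at h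
  exact mul_right_cancel₀ (eval_injPoly_self_pos hq mu).ne' h

theorem isSubgroupPoly_subgroupPoly (lam mu : YoungDiagram) :
    IsSubgroupPoly lam mu (subgroupPoly lam mu) := by
  have h : ∃ f, IsSubgroupPoly lam mu f := (exists_isSubgroupPoly lam mu).imp fun _ => And.left
  rw [subgroupPoly, dif_pos h]
  exact h.choose_spec

theorem surCard_eq {p : ℝ} (hp : 1 < p) (lam mu : YoungDiagram) :
    surCard p lam mu = aeval p (injPoly mu lam) := by
  obtain ⟨f, hf, hmul⟩ := exists_isSubgroupPoly lam mu
  rw [surCard, hmul, map_mul, (isSubgroupPoly_subgroupPoly lam mu).unique hf,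
    aeval_injPoly_self hp]

/-! ### Character duality: surjections against injections. -/

section Duality

variable {A B : Type*} [CommGroup A] [CommGroup B]

/-- The surjective homomorphisms from `A` to `B`. -/
abbrev SurMulHom (A B : Type*) [CommGroup A] [CommGroup B] : Type _ :=
  {f : A →* B // Function.Surjective f}

/-- The injective homomorphisms from `A` to `B`. -/
abbrev InjMulHom (A B : Type*) [CommGroup A] [CommGroup B] : Type _ :=
  {f : A →* B // Function.Injective f}

theorem card_injMulHom_congr {A' B' : Type*} [CommGroup A'] [CommGroup B'] (e : A ≃* A')
    (e' : B ≃* B') : Nat.card (InjMulHom A B) = Nat.card (InjMulHom A' B') := by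
  refine Nat.card_congr
    { toFun := fun f => ⟨(e'.toMonoidHom.comp f.1).comp e.symm.toMonoidHom,
        (e'.injective.comp f.2).comp e.symm.injective⟩
      invFun := fun f => ⟨(e'.symm.toMonoidHom.comp f.1).comp e.toMonoidHom,
        (e'.symm.injective.comp f.2).comp e.injective⟩
      left_inv := fun f => ?_
      right_inv := fun f => ?_ }
  · ext x
    simp
  · ext x
    simp

theorem card_surMulHom_congr {A' B' : Type*} [CommGroup A'] [CommGroup B'] (e : A ≃* A')
    (e' : B ≃* B') : Nat.card (SurMulHom A B) = Nat.card (SurMulHom A' B') := by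
  refine Nat.card_congr
    { toFun := fun f => ⟨(e'.toMonoidHom.comp f.1).comp e.symm.toMonoidHom,
        (e'.surjective.comp f.2).comp e.symm.surjective⟩
      invFun := fun f => ⟨(e'.symm.toMonoidHom.comp f.1).comp e.toMonoidHom,
        (e'.symm.surjective.comp f.2).comp e.surjective⟩
      left_inv := fun f => ?_
      right_inv := fun f => ?_ }
  · ext x
    simp
  · ext x
    simp

theorem exists_mulEquiv_dual (A : Type*) [CommGroup A] [Finite A] :
    Nonempty ((A →* ℂˣ) ≃* A) :=
  have : NeZero (Monoid.exponent A) := ⟨Monoid.exponent_ne_zero_of_finite⟩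
  CommGroup.monoidHom_mulEquiv_of_hasEnoughRootsOfUnity A ℂ

/-- Characters separate the points of `B`. -/
theorem compHom_dual_injective [Finite B] :
    Function.Injective fun f : A →* B => (MonoidHom.compHom' f : (B →* ℂˣ) →* (A →* ℂˣ)) := by
  have : NeZero (Monoid.exponent B) := ⟨Monoid.exponent_ne_zero_of_finite⟩
  intro f g h
  ext x
  exact (CommGroup.forall_apply_eq_apply_iff B (M := ℂ)).1 fun φ =>
    DFunLike.congr_fun (DFunLike.congr_fun h φ) x

theorem exists_extend_character [Finite B] {f : A →* B} (hf : Function.Injective f) :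
    Function.Surjective (MonoidHom.compHom' f : (B →* ℂˣ) →* (A →* ℂˣ)) := by
  have : NeZero (Monoid.exponent B) := ⟨Monoid.exponent_ne_zero_of_finite⟩
  intro χ
  obtain ⟨ψ, hψ⟩ := MonoidHom.domRestrict_surjective ℂ f.range
    (χ.comp (MonoidHom.ofInjective hf).symm.toMonoidHom)
  refine ⟨ψ, MonoidHom.ext fun x => ?_⟩
  have h : ψ (f x) = χ ((MonoidHom.ofInjective hf).symm (MonoidHom.ofInjective hf x)) :=
    DFunLike.congr_fun hψ (MonoidHom.ofInjective hf x)
  rwa [MulEquiv.symm_apply_apply] at h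

/-- Finite abelian groups `A`, `B` have as many surjections `A → B` as injections `B → A`. -/
theorem card_surMulHom_eq_card_injMulHom [Finite A] [Finite B] :
    Nat.card (SurMulHom A B) = Nat.card (InjMulHom B A) := by
  obtain ⟨eA⟩ := exists_mulEquiv_dual A
  obtain ⟨eB⟩ := exists_mulEquiv_dual B
  have : Finite (A →* ℂˣ) := Finite.of_equiv A eA.symm.toEquiv
  have : Finite (B →* ℂˣ) := Finite.of_equiv B eB.symm.toEquiv
  have : Finite ((A →* ℂˣ) →* (B →* ℂˣ)) := DFunLike.finite _
  have : Finite ((B →* ℂˣ) →* (A →* ℂˣ)) := DFunLike.finite _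
  -- Dualising embeds the surjections `A → B` into the injections between the dual groups, and the
  -- injections `B → A` into the surjections between them. Finite groups are isomorphic to their
  -- duals, so these give the two inequalities.
  apply le_antisymm
  · rw [← card_injMulHom_congr (A := B →* ℂˣ) (B := A →* ℂˣ) eB eA]
    refine Nat.card_le_card_of_injective
      (fun f => ⟨MonoidHom.compHom' f.1, fun φ ψ h => ?_⟩) fun f g h =>
        Subtype.ext (compHom_dual_injective (congrArg Subtype.val h))
    exact (MonoidHom.cancel_right f.2).1 h
  · rw [← card_surMulHom_congr (A := A →* ℂˣ) (B := B →* ℂˣ) eA eB]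
    exact Nat.card_le_card_of_injective
      (fun f => ⟨MonoidHom.compHom' f.1, exists_extend_character f.2⟩) fun f g h =>
        Subtype.ext (compHom_dual_injective (congrArg Subtype.val h))

end Duality

/-! ### Assembly of the moment formula. -/

theorem card_surjective_eq_card_injHom {G H : Type*} [AddCommGroup G] [AddCommGroup H] [Finite G]
    [Finite H] :
    Nat.card {f : G →+ H // Function.Surjective f} = Nat.card (InjHom H G) := by
  have h := card_surMulHom_eq_card_injMulHom (A := Multiplicative G) (B := Multiplicative H)
  have h1 : Nat.card {f : G →+ H // Function.Surjective f} =
      Nat.card (SurMulHom (Multiplicative G) (Multiplicative H)) :=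
    Nat.card_congr (AddMonoidHom.toMultiplicative.subtypeEquiv fun _ => Iff.rfl)
  have h2 : Nat.card (InjHom H G) =
      Nat.card (InjMulHom (Multiplicative H) (Multiplicative G)) :=
    Nat.card_congr (AddMonoidHom.toMultiplicative.subtypeEquiv fun _ => Iff.rfl)
  rw [h1, h, h2]

theorem hasSum_massP_mul_injPoly {p u : ℝ} (hp : 1 < p) (hu : 0 < u) (hup : u < p) (d : ℕ)
    (mu : YoungDiagram) :
    HasSum (fun lam => massP p u d lam * aeval p (injPoly mu lam)) (momentValue p u d mu) := by
  have hp0 : 0 < p := by linarith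
  refine ((hasSum_chainWeight_mul_injPoly hp hu hup mu d).mul_left
    (poch p (u / p) d * poch p (1 / p) d)).congr_eq (fun lam => ?_) ?_
  · rw [massP_eq hp, mul_assoc]
  · rw [momentValue, numParts_eq]
    split_ifs
    · have h1 := (poch_pos (x := u / p) hp (by positivity) ((div_lt_one hp0).2 hup) d).ne'
      have h2 := (poch_inv_pos hp (d - mu.colLen 0)).ne'
      field_simp
    · rw [mul_zero]

theorem theorem4 (p u : ℝ) (hp : 1 < p) (hu : 0 < u) (hup : u < p) (d : ℕ) (mu : YoungDiagram) :
    -- the counting polynomial exists, so that `surCard` is what it should be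
    (∀ lam : YoungDiagram, IsSubgroupPoly lam mu (subgroupPoly lam mu)) ∧
    -- the moment, for every real `p`
    HasSum (fun lam : YoungDiagram => massP p u d lam * surCard p lam mu)
      (momentValue p u d mu) ∧
    -- the moment as an expected number of surjections, when `p` is a prime
    (∀ q : ℕ, q.Prime → p = (q : ℝ) →
      HasSum (fun lam : YoungDiagram => massP p u d lam *
          (Nat.card {f : TypeGroup q lam →+ TypeGroup q mu // Function.Surjective f} : ℝ))
        (momentValue p u d mu)) := by
  have h := hasSum_massP_mul_injPoly hp hu hup d mu
  refine ⟨fun lam => isSubgroupPoly_subgroupPoly lam mu,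
    h.congr_eq (fun lam => by rw [surCard_eq hp]) rfl, ?_⟩
  rintro q hq rfl
  refine h.congr_eq (fun lam => ?_) rfl
  have := finite_seqGroup hq lam.rowLen (numParts lam)
  have := finite_seqGroup hq mu.rowLen (numParts mu)
  have h1 : (Nat.card (InjHom (TypeGroup q mu) (TypeGroup q lam)) : ℝ) =
      ((injPoly mu lam).eval (q : ℤ) : ℤ) := by
    rw [← card_injHom_typeGroup hq, Int.cast_natCast]
  rw [card_surjective_eq_card_injHom, h1]
  congr 1
  have h2 := aeval_algebraMap_apply ℝ (q : ℤ) (injPoly mu lam)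
  simpa using h2.symm
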